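/- Work in ZFC and write $\mathfrak c = 2^{\aleph_0}$. For an infinite cardinal $\mu$, $H_\mu$ is the set of all sets whose transitive closure has cardinality less than $\mu$, and $\mathrm{ZFC}^-$ is ZFC with the Power Set axiom removed. A poset (assumed nonempty) is ccc if each of its sets of pairwise incompatible elements is countable. The *local grounded Martin's Axiom* asserts that there are a cardinal $\kappa\ge\mathfrak c$ and a transitive model $M\subseteq H_{\kappa^+}$ of $\mathrm{ZFC}^-$ such that - $H_{\kappa^+}$ is a ccc forcing extension of $M$, that is, $H_{\kappa^+}=M[G]$ for some $M$-generic filter $G$ on some poset $\mathbb P\in M$ that is ccc in $M$; and - for every poset $\mathbb Q\in M$ that is ccc in $V$ and every family $\mathcal D\in V$ of fewer than $\mathfrak c$ dense subsets of $\mathbb Q$, there is in $V$ a filter on $\mathbb Q$ meeting every member of $\mathcal D$. **Corollary.** The local grounded Martin's Axiom implies that all cardinals on the right side of Cichoń's diagram are equal to the continuum. Explicitly, let $\mathcal B$ and $\mathcal L$ be the ideals of meager and of Lebesgue null sets of reals. Then $$\mathbf{cov}(\mathcal B)=\mathbf{non}(\mathcal L)=\mathfrak d=\mathbf{cof}(\mathcal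 B)=\mathbf{cof}(\mathcal L)=\mathfrak c .$$ Moreover, the reaping number is equal to the continuum: $\mathfrak r=\mathfrak c$. Here $\mathbf{cov}(\mathcal I)$ is the least size of a subfamily of $\mathcal I$ with union $\mathbb R$; $\mathbf{non}(\mathcal I)$ is the least size of a set of reals not in $\mathcal I$; $\mathbf{cof}(\mathcal I)$ is the least size of a family $\mathcal A\subseteq\mathcal I$ such that every member of $\mathcal I$ is included in a member of $\mathcal A$; $\mathfrak d$ is the least size of a family of functions $\omega\to\omega$ that dominates every function $\omega\to\omega$ at all but finitely many arguments; and $\mathfrak r$ is the least size of a family of infinite subsets of $\omega$ such that no single $s\subseteq\omega$ splits all its members, where $s$ splits $x$ if $x\cap s$ and $x\setminus s$ are both infinite. -/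

import Mathlib

open Cardinal

universe u

namespace GroundedMA

/-! ### The first-order language of set theory, and models of ZFC without Power Set

The set-theoretic universe `V` is `ZFSet.{u}`; a (possibly proper) class is a `Set ZFSet`. -/

/-- The only non-logical symbol of the language of set theory: a binary relation. -/
inductive SetRel : ℕ → Type
  | mem : SetRel 2

/-- The first-order language of set theory. -/
def setLang : FirstOrder.Language := ⟨fun _ => Empty, SetRel⟩

/-- A class `M` of sets, seen as the first-order structure `(M, ∈)`. -/
instance memStructure (M : Set ZFSet.{u}) : setLang.Structure M where
  funMap := fun f => Empty.elim f
  RelMap := fun {_} R =>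
    match R with
    | SetRel.mem => fun v => (v 0 : ZFSet.{u}) ∈ (v 1 : ZFSet.{u})

/-- `(M, ∈)` satisfies the axioms of ZFC other than Power Set. All quantifiers range over `M`, and
in the two schemas `Set.Definable₁ / Set.Definable₂` with parameter set `Set.univ` range over the
subsets of `M` and of `M × M` that are first-order definable over `(M, ∈)` with parameters. -/
structure ModelsZFCMinus (M : Set ZFSet.{u}) : Prop where
  extensionality : ∀ x y : M, (∀ z : M, z.1 ∈ x.1 ↔ z.1 ∈ y.1) → x = y
  foundation : ∀ x : M, (∃ y : M, y.1 ∈ x.1) →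
    ∃ y : M, y.1 ∈ x.1 ∧ ∀ z : M, z.1 ∈ y.1 → z.1 ∉ x.1
  pairing : ∀ x y : M, ∃ p : M, ∀ z : M, z.1 ∈ p.1 ↔ z = x ∨ z = y
  union : ∀ x : M, ∃ w : M, ∀ z : M, z.1 ∈ w.1 ↔ ∃ y : M, y.1 ∈ x.1 ∧ z.1 ∈ y.1
  infinity : ∃ x : M, (∃ e : M, e.1 ∈ x.1 ∧ ∀ z : M, z.1 ∉ e.1) ∧
    ∀ y : M, y.1 ∈ x.1 → ∃ s : M, s.1 ∈ x.1 ∧ ∀ z : M, z.1 ∈ s.1 ↔ z.1 ∈ y.1 ∨ z = y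
  separation : ∀ S : Set M, Set.univ.Definable₁ setLang S →
    ∀ a : M, ∃ b : M, ∀ z : M, z.1 ∈ b.1 ↔ z.1 ∈ a.1 ∧ z ∈ S
  replacement : ∀ R : Set (M × M), Set.univ.Definable₂ setLang R →
    ∀ a : M, (∀ x : M, x.1 ∈ a.1 → ∃! y : M, (x, y) ∈ R) →
      ∃ b : M, ∀ y : M, y.1 ∈ b.1 ↔ ∃ x : M, x.1 ∈ a.1 ∧ (x, y) ∈ R
  choice : ∀ x : M, (∀ y : M, y.1 ∈ x.1 → ∃ z : M, z.1 ∈ y.1) →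
    (∀ y y' : M, y.1 ∈ x.1 → y'.1 ∈ x.1 → y ≠ y' → ∀ z : M, ¬ (z.1 ∈ y.1 ∧ z.1 ∈ y'.1)) →
    ∃ c : M, ∀ y : M, y.1 ∈ x.1 → ∃! z : M, z.1 ∈ c.1 ∧ z.1 ∈ y.1

/-- `M` is a transitive class. -/
def IsTransitiveClass (M : Set ZFSet.{u}) : Prop :=
  ∀ x ∈ M, ∀ y ∈ x, y ∈ M

/-- `H_μ`, the class of sets whose transitive closure has cardinality less than `μ`
(equivalently, which are included in a transitive set of cardinality less than `μ`). -/
def hereditarilySmall (μ : Cardinal.{u}) : Set ZFSet.{u} :=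
  {x | ∃ t : ZFSet.{u}, t.IsTransitive ∧ x ⊆ t ∧ t.card < μ}

/-! ### Posets -/

/-- `(P, R)` is a nonempty partially ordered set; `pair p q ∈ R` means `p ≤ q`. -/
structure IsPoset (P R : ZFSet.{u}) : Prop where
  nonempty : P.Nonempty
  subset_prod : R ⊆ P.prod P
  refl : ∀ p ∈ P, ZFSet.pair p p ∈ R
  antisymm : ∀ p q, ZFSet.pair p q ∈ R → ZFSet.pair q p ∈ R → p = q
  trans : ∀ p q r, ZFSet.pair p q ∈ R → ZFSet.pair q r ∈ R → ZFSet.pair p r ∈ R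

/-- `p` and `q` have a common lower bound in `(P, R)`. -/
def Compatible (P R p q : ZFSet.{u}) : Prop :=
  ∃ r ∈ P, ZFSet.pair r p ∈ R ∧ ZFSet.pair r q ∈ R

/-- `A` is a set of pairwise incompatible elements of `(P, R)`. -/
def IsStrongAntichain (P R : ZFSet.{u}) (A : Set ZFSet.{u}) : Prop :=
  (∀ p ∈ A, p ∈ P) ∧ ∀ p ∈ A, ∀ q ∈ A, p ≠ q → ¬ Compatible P R p q

/-- `D` is a dense subset of `(P, R)`. -/
def IsDense (P R : ZFSet.{u}) (D : Set ZFSet.{u}) : Prop :=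
  (∀ p ∈ D, p ∈ P) ∧ ∀ p ∈ P, ∃ d ∈ D, ZFSet.pair d p ∈ R

/-- `F` is a filter on `(P, R)`: nonempty, upward closed and downward directed. -/
structure IsPosetFilter (P R : ZFSet.{u}) (F : Set ZFSet.{u}) : Prop where
  subset : ∀ p ∈ F, p ∈ P
  nonempty : F.Nonempty
  upward : ∀ p ∈ F, ∀ q, ZFSet.pair p q ∈ R → q ∈ F
  directed : ∀ p ∈ F, ∀ q ∈ F, ∃ r ∈ F, ZFSet.pair r p ∈ R ∧ ZFSet.pair r q ∈ R

/-- `(P, R)` has the countable chain condition in `V`. -/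
def IsCCC (P R : ZFSet.{u}) : Prop :=
  ∀ A : Set ZFSet.{u}, IsStrongAntichain P R A → A.Countable

/-- `M` thinks that `(P, R)` has the countable chain condition: every antichain that is an element
of `M` is injected into `ω` by some function that is an element of `M`. -/
def IsCCCIn (M : Set ZFSet.{u}) (P R : ZFSet.{u}) : Prop :=
  ∀ A ∈ M, IsStrongAntichain P R (A : Set ZFSet.{u}) →
    ∃ f ∈ M, ZFSet.IsFunc A ZFSet.omega f ∧
      ∀ a b n, ZFSet.pair a n ∈ f → ZFSet.pair b n ∈ f → a = b

/-- The conclusion of Martin's Axiom for `(Q, R)`: for every family of fewer than continuum many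
dense subsets there is a filter that meets all of them. -/
def MAConclusion (Q R : ZFSet.{u}) : Prop :=
  ∀ 𝒟 : Set (Set ZFSet.{u}), #𝒟 < 𝔠 → (∀ D ∈ 𝒟, IsDense Q R D) →
    ∃ F : Set ZFSet.{u}, IsPosetFilter Q R F ∧ ∀ D ∈ 𝒟, (F ∩ D).Nonempty

/-! ### Forcing extensions -/

/-- `τ` is a `P`-name: a set of pairs `(σ, p)` with `σ` a `P`-name and `p ∈ P`. -/
inductive IsName (P : ZFSet.{u}) : ZFSet.{u} → Prop
  | mk (τ : ZFSet.{u})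
      (isPair : ∀ z ∈ τ, ∃ σ p, p ∈ P ∧ z = ZFSet.pair σ p)
      (isName : ∀ σ p, ZFSet.pair σ p ∈ τ → IsName P σ) : IsName P τ

theorem rank_lt_of_pair_mem {σ p τ : ZFSet.{u}} (h : ZFSet.pair σ p ∈ τ) :
    σ.rank < τ.rank := by
  have h1 : σ ∈ ({σ} : ZFSet.{u}) := ZFSet.mem_singleton.2 rfl
  have h2 : ({σ} : ZFSet.{u}) ∈ ZFSet.pair σ p := by
    unfold ZFSet.pair
    exact ZFSet.mem_pair.2 (Or.inl rfl)
  exact ((ZFSet.rank_lt_of_mem h1).trans (ZFSet.rank_lt_of_mem h2)).trans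
    (ZFSet.rank_lt_of_mem h)

instance small_nameDomain (G : Set ZFSet.{u}) (τ : ZFSet.{u}) :
    Small.{u} {σ : ZFSet.{u} // ∃ p ∈ G, ZFSet.pair σ p ∈ τ} := by
  let c : {σ : ZFSet.{u} // ∃ p ∈ G, ZFSet.pair σ p ∈ τ} → τ :=
    fun s => ⟨ZFSet.pair s.1 s.2.choose, s.2.choose_spec.2⟩
  refine small_of_injective (f := c) fun s t h => Subtype.ext ?_
  exact (ZFSet.pair_inj.1 (congrArg Subtype.val h)).1

/-- The interpretation `τ^G = {σ^G : (σ, p) ∈ τ for some p ∈ G}`, by recursion on `τ`. -/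
noncomputable def nameVal (G : Set ZFSet.{u}) (τ : ZFSet.{u}) : ZFSet.{u} :=
  ZFSet.range fun s : {σ : ZFSet.{u} // ∃ p ∈ G, ZFSet.pair σ p ∈ τ} => nameVal G s.1
termination_by τ.rank
decreasing_by exact rank_lt_of_pair_mem s.2.choose_spec.2

theorem mem_nameVal {G : Set ZFSet.{u}} {τ x : ZFSet.{u}} :
    x ∈ nameVal G τ ↔ ∃ σ, (∃ p ∈ G, ZFSet.pair σ p ∈ τ) ∧ nameVal G σ = x := by
  rw [nameVal, ZFSet.mem_range]
  simp only [Subtype.exists, exists_prop]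

/-- `G` is an `M`-generic filter on `(P, R)`. -/
def IsGeneric (M : Set ZFSet.{u}) (P R : ZFSet.{u}) (G : Set ZFSet.{u}) : Prop :=
  IsPosetFilter P R G ∧
    ∀ D ∈ M, IsDense P R (D : Set ZFSet.{u}) → (G ∩ (D : Set ZFSet.{u})).Nonempty

/-- `M[G]`, the class of interpretations of the `P`-names in `M`. -/
def genericExtension (M : Set ZFSet.{u}) (P : ZFSet.{u}) (G : Set ZFSet.{u}) : Set ZFSet.{u} :=
  {x | ∃ τ ∈ M, IsName P τ ∧ nameVal G τ = x}

/-- `N` is a ccc forcing extension of `M`: `N = M[G]` for an `M`-generic filter `G` on a poset in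
`M` which is ccc in `M`. -/
def IsCCCExtension (M N : Set ZFSet.{u}) : Prop :=
  ∃ P R : ZFSet.{u}, ZFSet.pair P R ∈ M ∧ IsPoset P R ∧ IsCCCIn M P R ∧
    ∃ G : Set ZFSet.{u}, IsGeneric M P R G ∧ N = genericExtension M P G

/-- The local grounded Martin's Axiom in the universe `ZFSet.{u}`. -/
def LocalGroundedMA : Prop :=
  ∃ κ : Cardinal.{u}, 𝔠 ≤ κ ∧
    ∃ M : Set ZFSet.{u}, IsTransitiveClass M ∧ ModelsZFCMinus M ∧
      M ⊆ hereditarilySmall (Order.succ κ) ∧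
      IsCCCExtension M (hereditarilySmall (Order.succ κ)) ∧
      ∀ Q R : ZFSet.{u}, ZFSet.pair Q R ∈ M → IsPoset Q R → IsCCC Q R → MAConclusion Q R

/-! ### Cardinal characteristics of the continuum -/

/-- The ideal of meager sets of reals. -/
def meagerIdeal : Set (Set ℝ) := {A | IsMeagre A}

/-- The ideal of Lebesgue null sets of reals. -/
def nullIdeal : Set (Set ℝ) := {A | MeasureTheory.volume A = 0}

/-- The covering number: the least number of members of `I` that cover the whole space. -/
noncomputable def cov {X : Type} (I : Set (Set X)) : Cardinal.{0} :=
  sInf {c | ∃ 𝒜 : Set (Set X), 𝒜 ⊆ I ∧ ⋃₀ 𝒜 = Set.univ ∧ #𝒜 = c}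

/-- The uniformity: the least cardinality of a set that is not in `I`. -/
noncomputable def non {X : Type} (I : Set (Set X)) : Cardinal.{0} :=
  sInf {c | ∃ A : Set X, A ∉ I ∧ #A = c}

/-- The cofinality: the least cardinality of a cofinal subfamily of `(I, ⊆)`. -/
noncomputable def cof {X : Type} (I : Set (Set X)) : Cardinal.{0} :=
  sInf {c | ∃ 𝒜 : Set (Set X), 𝒜 ⊆ I ∧ (∀ B ∈ I, ∃ A ∈ 𝒜, B ⊆ A) ∧ #𝒜 = c}

/-- The dominating number `𝔡`. -/
noncomputable def dominatingNumber : Cardinal.{0} :=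
  sInf {c | ∃ ℱ : Set (ℕ → ℕ), (∀ g : ℕ → ℕ, ∃ f ∈ ℱ, ∀ᶠ n in Filter.atTop, g n ≤ f n) ∧ #ℱ = c}

/-- `s` splits `x` if both `x ∩ s` and `x \ s` are infinite. -/
def Splits (s x : Set ℕ) : Prop := (x ∩ s).Infinite ∧ (x \ s).Infinite

/-- The reaping number `𝔯`: the least cardinality of a family of infinite subsets of `ℕ` that is
not split by a single set. -/
noncomputable def reapingNumber : Cardinal.{0} :=
  sInf {c | ∃ ℛ : Set (Set ℕ), (∀ x ∈ ℛ, x.Infinite) ∧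
    (¬ ∃ s : Set ℕ, ∀ x ∈ ℛ, Splits s x) ∧ #ℛ = c}

end GroundedMA

/-! The axiom is applied to a single poset, Cohen forcing, taken as the finite sets of natural
numbers under end-extension. It lies in every transitive model of ZFC without Power Set
(`ModelsZFCMinus.exists_isCohenPoset`), being the union of a definable sequence of finite sets, and
it is countable, hence ccc in V.

Cohen forcing projects onto every countable preorder: a finite set of stages prescribes a finite
descent through an enumeration. So fewer than 𝔠 dense sets can be met in any countable preorder
(`countableMA_of_isCohenPoset`).

Generic sequences escape small dominating families and split small families of infinite sets; a
generic real, from rational intervals, avoids few meager sets. This bounds 𝔡, 𝔯 and cov(B) below by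
𝔠. Rothberger's translation argument gives cov(B) ≤ non(L), and the cofinalities dominate cov(B) and
non(L) respectively. The upper bounds come from |ℝ| = 𝔠 and from Borel bases of the two ideals. -/

namespace GroundedMA

/-! ### Definable predicates over a class -/

section Definability

/-- The membership symbol of the language of set theory. -/
def memSymbol : setLang.Relations 2 := SetRel.mem

variable {M : Set ZFSet.{u}} {α : Type}

/-- The predicate `p` on `M`-valued tuples is definable over `(M, ∈)` with parameters. -/
def IsDefinablePred (p : (α → M) → Prop) : Prop :=
  (Set.univ : Set M).Definable setLang {v | p v}

namespace IsDefinablePred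

theorem mem (i j : α) : IsDefinablePred fun v : α → M => (v i).1 ∈ (v j).1 := by
  refine Set.Definable.mono (A := ∅) ?_ (Set.empty_subset _)
  rw [Set.empty_definable_iff]
  refine ⟨FirstOrder.Language.Relations.formula₂ memSymbol
    (FirstOrder.Language.Term.var i) (FirstOrder.Language.Term.var j), ?_⟩
  ext v
  rw [Set.mem_ofPred_eq, Set.mem_ofPred_eq, FirstOrder.Language.Formula.realize_rel₂]
  rfl

theorem eq (i j : α) : IsDefinablePred fun v : α → M => v i = v j := by
  refine Set.Definable.mono (A := ∅) ?_ (Set.empty_subset _)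
  rw [Set.empty_definable_iff]
  refine ⟨FirstOrder.Language.Term.equal (L := setLang)
    (FirstOrder.Language.Term.var i) (FirstOrder.Language.Term.var j), ?_⟩
  ext v
  rw [Set.mem_ofPred_eq, Set.mem_ofPred_eq, FirstOrder.Language.Formula.realize_equal]
  rfl

theorem and {p q : (α → M) → Prop} (hp : IsDefinablePred p) (hq : IsDefinablePred q) :
    IsDefinablePred fun v => p v ∧ q v :=
  Set.Definable.inter hp hq

theorem or {p q : (α → M) → Prop} (hp : IsDefinablePred p) (hq : IsDefinablePred q) :
    IsDefinablePred fun v => p v ∨ q v :=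
  Set.Definable.union hp hq

theorem not {p : (α → M) → Prop} (hp : IsDefinablePred p) : IsDefinablePred fun v => ¬ p v :=
  Set.Definable.compl hp

theorem imp {p q : (α → M) → Prop} (hp : IsDefinablePred p) (hq : IsDefinablePred q) :
    IsDefinablePred fun v => p v → q v := by
  simpa only [imp_iff_not_or] using hp.not.or hq

theorem iff {p q : (α → M) → Prop} (hp : IsDefinablePred p) (hq : IsDefinablePred q) :
    IsDefinablePred fun v => (p v ↔ q v) := by
  simpa only [iff_iff_implies_and_implies] using (hp.imp hq).and (hq.imp hp)

/-- Quantification is projection along the extra coordinate `none`; nested quantifiers just iterate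
`Option`. -/
theorem ex [Finite α] {q : M → (α → M) → Prop}
    (hq : IsDefinablePred fun v : Option α → M => q (v none) fun a => v (some a)) :
    IsDefinablePred fun v : α → M => ∃ z, q z v := by
  have h := Set.Definable.image_comp hq (some : α → Option α)
  unfold IsDefinablePred
  convert h using 1
  ext v
  simp only [Set.mem_ofPred_eq, Set.mem_image]
  constructor
  · rintro ⟨z, hz⟩
    exact ⟨fun o => o.elim z v, hz, rfl⟩
  · rintro ⟨w, hw, rfl⟩
    exact ⟨w none, hw⟩

theorem all [Finite α] {q : M → (α → M) → Prop}
    (hq : IsDefinablePred fun v : Option α → M => q (v none) fun a => v (some a)) :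
    IsDefinablePred fun v : α → M => ∀ z, q z v := by
  have h := (IsDefinablePred.ex (q := fun z v => ¬ q z v) hq.not).not
  simpa only [not_exists, not_not] using h

end IsDefinablePred

/-- A predicate in two variables that is definable over `(M, ∈)` with parameters. -/
def IsDefinableRel (φ : M → M → Prop) : Prop :=
  ∀ {α : Type} [Finite α] (i j : α), IsDefinablePred fun v : α → M => φ (v i) (v j)

end Definability

/-! ### Finite ordinals -/

/-- The von Neumann natural numbers. -/
noncomputable def natSet : ℕ → ZFSet.{u}
  | 0 => ∅
  | n + 1 => insert (natSet n) (natSet n)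

theorem mem_natSet {n : ℕ} {z : ZFSet.{u}} : z ∈ natSet n ↔ ∃ m < n, z = natSet m := by
  induction n with
  | zero => simp [natSet]
  | succ n ih =>
    rw [natSet, ZFSet.mem_insert_iff, ih]
    constructor
    · rintro (h | ⟨m, hm, h⟩)
      · exact ⟨n, by omega, h⟩
      · exact ⟨m, by omega, h⟩
    · rintro ⟨m, hm, h⟩
      rcases Nat.lt_succ_iff_lt_or_eq.1 hm with hm | rfl
      · exact Or.inr ⟨m, hm, h⟩
      · exact Or.inl h

theorem natSet_mem_natSet {m n : ℕ} : natSet.{u} m ∈ natSet.{u} n ↔ m < n := by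
  have key : ∀ {m n : ℕ}, m < n → natSet.{u} m ∈ natSet.{u} n :=
    fun h => mem_natSet.2 ⟨_, h, rfl⟩
  refine ⟨fun h => ?_, key⟩
  by_contra hmn
  rcases Nat.eq_or_lt_of_not_lt hmn with rfl | hlt
  · exact ZFSet.mem_irrefl _ h
  · exact ZFSet.mem_asymm h (key hlt)

theorem natSet_injective : Function.Injective natSet.{u} := by
  intro m n h
  rcases lt_trichotomy m n with hlt | rfl | hlt
  · exact absurd (h ▸ natSet_mem_natSet.2 hlt) (ZFSet.mem_irrefl _)
  · rfl
  · exact absurd (h ▸ natSet_mem_natSet.2 hlt) (ZFSet.mem_irrefl _)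

theorem natSet_mono {m n : ℕ} (h : m ≤ n) : natSet.{u} m ⊆ natSet n := by
  intro z hz
  obtain ⟨k, hk, rfl⟩ := mem_natSet.1 hz
  exact natSet_mem_natSet.2 (hk.trans_le h)

theorem finite_natSet (n : ℕ) : {z | z ∈ natSet.{u} n}.Finite := by
  refine ((Set.finite_lt_nat n).image natSet).subset fun z hz => ?_
  obtain ⟨m, hm, rfl⟩ := mem_natSet.1 hz
  exact ⟨m, hm, rfl⟩

theorem finite_subsets_natSet (n : ℕ) : {z : ZFSet.{u} | z ⊆ natSet n}.Finite := by
  refine Set.Finite.of_finite_image (f := fun z : ZFSet.{u} => {x | x ∈ z})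
    ((finite_natSet n).finite_subsets.subset ?_) ?_
  · rintro _ ⟨z, hz, rfl⟩
    exact fun x hx => hz hx
  · intro x _ y _ h
    exact ZFSet.ext fun z => Set.ext_iff.1 h z

/-- A transitive set all of whose members, and itself, are zero or successors, is a natural
number. -/
theorem exists_eq_natSet {x : ZFSet.{u}} (htr : ∀ y ∈ x, y ⊆ x)
    (hs : ∀ w, w ∈ x ∨ w = x → w = ∅ ∨ ∃ v ∈ w, w = insert v v) : ∃ n, x = natSet n := by
  -- Induction on membership must cover `x` and its members at once, since the predecessor of `w` is
  -- found inside `w`.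
  have key : ∀ w, w ∈ x ∨ w = x → ∃ n, w = natSet n := by
    intro w
    induction w using ZFSet.inductionOn with
    | h w ih =>
      intro hw
      rcases hs w hw with rfl | ⟨v, hv, hvw⟩
      · exact ⟨0, rfl⟩
      · have hvx : v ∈ x := by
          rcases hw with hw | rfl
          · exact htr w hw hv
          · exact hv
        obtain ⟨n, rfl⟩ := ih v hv (Or.inl hvx)
        exact ⟨n + 1, hvw⟩
  exact key x (Or.inr rfl)

/-! ### Closure properties of transitive models -/

section Model

variable {M : Set ZFSet.{u}}

theorem ModelsZFCMinus.empty_mem (hM : ModelsZFCMinus M) (hT : IsTransitiveClass M) : ∅ ∈ M := by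
  obtain ⟨x, ⟨e, -, he⟩, -⟩ := hM.infinity
  have : e.1 = ∅ := (ZFSet.eq_empty _).2 fun z hz => he ⟨z, hT _ e.2 z hz⟩ hz
  exact this ▸ e.2

theorem ModelsZFCMinus.pair_mem (hM : ModelsZFCMinus M) (hT : IsTransitiveClass M)
    {a b : ZFSet.{u}} (ha : a ∈ M) (hb : b ∈ M) : ({a, b} : ZFSet.{u}) ∈ M := by
  obtain ⟨p, hp⟩ := hM.pairing ⟨a, ha⟩ ⟨b, hb⟩
  have : ({a, b} : ZFSet.{u}) = p.1 := by
    ext z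
    rw [ZFSet.mem_pair]
    constructor
    · rintro (rfl | rfl)
      · exact (hp ⟨z, ha⟩).2 (Or.inl rfl)
      · exact (hp ⟨z, hb⟩).2 (Or.inr rfl)
    · intro hz
      simpa [Subtype.ext_iff] using (hp ⟨z, hT _ p.2 z hz⟩).1 hz
  exact this ▸ p.2

theorem ModelsZFCMinus.singleton_mem (hM : ModelsZFCMinus M) (hT : IsTransitiveClass M)
    {a : ZFSet.{u}} (ha : a ∈ M) : ({a} : ZFSet.{u}) ∈ M := by
  rw [← ZFSet.pair_eq_singleton]
  exact hM.pair_mem hT ha ha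

theorem ModelsZFCMinus.orderedPair_mem (hM : ModelsZFCMinus M) (hT : IsTransitiveClass M)
    {a b : ZFSet.{u}} (ha : a ∈ M) (hb : b ∈ M) : ZFSet.pair a b ∈ M :=
  hM.pair_mem hT (hM.singleton_mem hT ha) (hM.pair_mem hT ha hb)

theorem ModelsZFCMinus.sUnion_mem (hM : ModelsZFCMinus M) (hT : IsTransitiveClass M)
    {a : ZFSet.{u}} (ha : a ∈ M) : ZFSet.sUnion a ∈ M := by
  obtain ⟨w, hw⟩ := hM.union ⟨a, ha⟩
  have : ZFSet.sUnion a = w.1 := by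
    ext z
    rw [ZFSet.mem_sUnion]
    constructor
    · rintro ⟨y, hy, hz⟩
      have hyM := hT _ ha y hy
      exact (hw ⟨z, hT _ hyM z hz⟩).2 ⟨⟨y, hyM⟩, hy, hz⟩
    · intro hz
      obtain ⟨y, hy, hzy⟩ := (hw ⟨z, hT _ w.2 z hz⟩).1 hz
      exact ⟨y.1, hy, hzy⟩
  exact this ▸ w.2

theorem ModelsZFCMinus.insert_mem (hM : ModelsZFCMinus M) (hT : IsTransitiveClass M)
    {a b : ZFSet.{u}} (ha : a ∈ M) (hb : b ∈ M) : (insert a b : ZFSet.{u}) ∈ M := by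
  have h := hM.sUnion_mem hT (hM.pair_mem hT (hM.singleton_mem hT ha) hb)
  convert h using 1
  ext z
  simp

/-- A finite set of members of a transitive model is a member of the model. -/
theorem ModelsZFCMinus.exists_of_finite (hM : ModelsZFCMinus M) (hT : IsTransitiveClass M)
    {S : Set ZFSet.{u}} (hS : S.Finite) (hSM : S ⊆ M) : ∃ b ∈ M, ∀ z, z ∈ b ↔ z ∈ S := by
  induction S, hS using Set.Finite.induction_on with
  | empty => exact ⟨∅, hM.empty_mem hT, by simp⟩
  | @insert a S _ _ ih =>
    obtain ⟨b, hb, hbS⟩ := ih ((Set.subset_insert a S).trans hSM)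
    exact ⟨insert a b, hM.insert_mem hT (hSM (Set.mem_insert a S)) hb, by simp [hbS]⟩

theorem ModelsZFCMinus.natSet_mem (hM : ModelsZFCMinus M) (hT : IsTransitiveClass M) (n : ℕ) :
    natSet n ∈ M := by
  induction n with
  | zero => exact hM.empty_mem hT
  | succ n ih => exact hM.insert_mem hT ih ih

theorem ModelsZFCMinus.mem_of_subset_natSet (hM : ModelsZFCMinus M) (hT : IsTransitiveClass M)
    {n : ℕ} {z : ZFSet.{u}} (hz : z ⊆ natSet n) : z ∈ M := by
  obtain ⟨b, hb, h⟩ := hM.exists_of_finite hT (S := {x | x ∈ z})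
    ((finite_natSet n).subset fun x hx => hz hx)
    fun x hx => hT _ (hM.natSet_mem hT n) x (hz hx)
  have : z = b := ZFSet.ext fun x => (h x).symm
  exact this ▸ hb

/-- The set of natural numbers is a member of every transitive model. -/
theorem ModelsZFCMinus.exists_omega (hM : ModelsZFCMinus M) (hT : IsTransitiveClass M) :
    ∃ o ∈ M, ∀ z, z ∈ o ↔ ∃ n, z = natSet n := by
  obtain ⟨x, ⟨e, hex, he⟩, hx⟩ := hM.infinity
  have hnx : ∀ n, natSet n ∈ x.1 := by
    intro n
    induction n with
    | zero =>
      have : e.1 = ∅ := (ZFSet.eq_empty _).2 fun z hz => he ⟨z, hT _ e.2 z hz⟩ hz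
      rw [natSet, ← this]
      exact hex
    | succ n ih =>
      obtain ⟨s, hsx, hs⟩ := hx ⟨natSet n, hM.natSet_mem hT n⟩ ih
      have : natSet (n + 1) = s.1 := by
        ext z
        rw [natSet, ZFSet.mem_insert_iff]
        constructor
        · rintro (rfl | hz)
          · exact (hs ⟨_, hM.natSet_mem hT n⟩).2 (Or.inr rfl)
          · exact (hs ⟨z, hT _ (hM.natSet_mem hT n) z hz⟩).2 (Or.inl hz)
        · intro hz
          have := (hs ⟨z, hT _ s.2 z hz⟩).1 hz
          simpa [Subtype.ext_iff, or_comm] using this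
      exact this ▸ hsx
  -- The inductive set given by Infinity may have extra members. This first-order description of the
  -- finite ordinals lets Separation discard them.
  let S : Set M := {x | (∀ y : M, y.1 ∈ x.1 → ∀ z : M, z.1 ∈ y.1 → z.1 ∈ x.1) ∧
    ∀ w : M, (w.1 ∈ x.1 ∨ w = x) → (∀ z : M, z.1 ∉ w.1) ∨
      ∃ v : M, v.1 ∈ w.1 ∧ ∀ z : M, z.1 ∈ w.1 ↔ (z = v ∨ z.1 ∈ v.1)}
  have hS : (Set.univ : Set M).Definable₁ setLang S := by
    change IsDefinablePred fun v : Fin 1 → M =>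
      (∀ y : M, y.1 ∈ (v 0).1 → ∀ z : M, z.1 ∈ y.1 → z.1 ∈ (v 0).1) ∧
      ∀ w : M, (w.1 ∈ (v 0).1 ∨ w = v 0) → (∀ z : M, z.1 ∉ w.1) ∨
        ∃ u : M, u.1 ∈ w.1 ∧ ∀ z : M, z.1 ∈ w.1 ↔ (z = u ∨ z.1 ∈ u.1)
    refine .and (.all (.imp (.mem _ _) (.all (.imp (.mem _ _) (.mem _ _)))))
      (.all (.imp (.or (.mem _ _) (.eq _ _)) (.or (.all (.not (.mem _ _)))
        (.ex (.and (.mem _ _) (.all (.iff (.mem _ _) (.or (.eq _ _) (.mem _ _)))))))))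
  obtain ⟨o, ho⟩ := hM.separation S hS x
  refine ⟨o.1, o.2, fun z => ⟨fun hz => ?_, ?_⟩⟩
  · have hzM := hT _ o.2 z hz
    obtain ⟨-, h1, h2⟩ := (ho ⟨z, hzM⟩).1 hz
    refine exists_eq_natSet (fun y hy w hw => ?_) fun w hw => ?_
    · have hyM := hT _ hzM y hy
      exact h1 ⟨y, hyM⟩ hy ⟨w, hT _ hyM w hw⟩ hw
    · have hwM : w ∈ M := by
        rcases hw with hw | rfl
        · exact hT _ hzM w hw
        · exact hzM
      rcases h2 ⟨w, hwM⟩ (by simpa [Subtype.ext_iff] using hw) with h | ⟨v, hv, h⟩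
      · exact Or.inl ((ZFSet.eq_empty _).2 fun z hz => h ⟨z, hT _ hwM z hz⟩ hz)
      · refine Or.inr ⟨v.1, hv, ZFSet.ext fun z => ?_⟩
        rw [ZFSet.mem_insert_iff]
        constructor
        · intro hz
          simpa [Subtype.ext_iff] using (h ⟨z, hT _ hwM z hz⟩).1 hz
        · rintro (rfl | hz)
          · exact hv
          · exact (h ⟨z, hT _ v.2 z hz⟩).2 (Or.inr hz)
  · rintro ⟨n, rfl⟩
    refine (ho ⟨natSet n, hM.natSet_mem hT n⟩).2 ⟨hnx n, fun y hy z hz => ?_, fun w hw => ?_⟩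
    · obtain ⟨m, hm, hy⟩ := mem_natSet.1 hy
      rw [hy] at hz
      exact natSet_mono hm.le hz
    · have : ∃ m, w.1 = natSet m := by
        rcases hw with hw | rfl
        · obtain ⟨m, -, h⟩ := mem_natSet.1 hw
          exact ⟨m, h⟩
        · exact ⟨n, rfl⟩
      obtain ⟨m, hm⟩ := this
      rw [hm]
      rcases m with _ | m
      · exact Or.inl fun z => ZFSet.notMem_empty _
      · refine Or.inr ⟨⟨natSet m, hM.natSet_mem hT m⟩, natSet_mem_natSet.2 m.lt_succ_self,
          fun z => ?_⟩
        rw [natSet, ZFSet.mem_insert_iff, Subtype.ext_iff]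

/-- The union of a definable sequence of finite sets of members of a transitive model is a member
of the model. -/
theorem ModelsZFCMinus.exists_iUnion_of_finite (hM : ModelsZFCMinus M) (hT : IsTransitiveClass M)
    {S : ℕ → Set ZFSet.{u}} (hfin : ∀ n, (S n).Finite) (hSM : ∀ n, S n ⊆ M)
    {φ : M → M → Prop} (hφ : IsDefinableRel φ)
    (hS : ∀ (n : ℕ) (z x : M), x.1 = natSet n → (φ z x ↔ z.1 ∈ S n)) :
    ∃ b ∈ M, ∀ z, z ∈ b ↔ ∃ n, z ∈ S n := by
  obtain ⟨o, hoM, ho⟩ := hM.exists_omega hT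
  -- `R` sends the number n to the set `S n`, which is in `M` because it is finite. Replacement on ω
  -- followed by Union then replaces any appeal to power sets.
  let R : Set (M × M) := {q | ∀ z : M, z.1 ∈ q.2.1 ↔ φ z q.1}
  have hR : (Set.univ : Set M).Definable₂ setLang R := by
    change IsDefinablePred fun v : Fin 2 → M => ∀ z : M, z.1 ∈ (v 1).1 ↔ φ z (v 0)
    exact .all (.iff (.mem _ _) (hφ _ _))
  have hval : ∀ (n : ℕ) (x y : M), x.1 = natSet n → ((x, y) ∈ R ↔ ∀ z, z ∈ y.1 ↔ z ∈ S n) := by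
    intro n x y hx
    constructor
    · intro h z
      constructor
      · intro hz
        exact (hS n ⟨z, hT _ y.2 z hz⟩ x hx).1 ((h ⟨z, hT _ y.2 z hz⟩).1 hz)
      · intro hz
        exact (h ⟨z, hSM n hz⟩).2 ((hS n ⟨z, hSM n hz⟩ x hx).2 hz)
    · intro h z
      exact (h z.1).trans (hS n z x hx).symm
  obtain ⟨b, hb⟩ := hM.replacement R hR ⟨o, hoM⟩ fun x hx => by
    obtain ⟨n, hn⟩ := (ho _).1 hx
    obtain ⟨y, hyM, hy⟩ := hM.exists_of_finite hT (hfin n) (hSM n)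
    refine ⟨⟨y, hyM⟩, (hval n x _ hn).2 hy, fun y' hy' => ?_⟩
    exact Subtype.ext (ZFSet.ext fun z => ((hval n x y' hn).1 hy' z).trans (hy z).symm)
  refine ⟨ZFSet.sUnion b.1, hM.sUnion_mem hT b.2, fun z => ?_⟩
  rw [ZFSet.mem_sUnion]
  constructor
  · rintro ⟨y, hy, hz⟩
    obtain ⟨x, hx, hxy⟩ := (hb ⟨y, hT _ b.2 y hy⟩).1 hy
    obtain ⟨n, hn⟩ := (ho _).1 hx
    exact ⟨n, ((hval n x _ hn).1 hxy z).1 hz⟩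
  · rintro ⟨n, hz⟩
    obtain ⟨y, hyM, hy⟩ := hM.exists_of_finite hT (hfin n) (hSM n)
    refine ⟨y, (hb ⟨y, hyM⟩).2 ⟨⟨natSet n, hM.natSet_mem hT n⟩, (ho _).2 ⟨n, rfl⟩, ?_⟩, (hy z).2 hz⟩
    exact (hval n _ _ rfl).2 hy

end Model

/-! ### Cohen forcing -/

/-- `s` end-extends `t`, for sets `s`, `t` of von Neumann natural numbers. -/
def EndExtends (s t : ZFSet.{u}) : Prop :=
  (∀ v ∈ t, v ∈ s) ∧ ∀ v ∈ t, ∀ w ∈ s, w ∈ v → w ∈ t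

theorem EndExtends.refl (s : ZFSet.{u}) : EndExtends s s :=
  ⟨fun _ h => h, fun _ _ _ h _ => h⟩

theorem EndExtends.trans {r s t : ZFSet.{u}} (h₁ : EndExtends r s) (h₂ : EndExtends s t) :
    EndExtends r t :=
  ⟨fun v hv => h₁.1 v (h₂.1 v hv),
    fun v hv w hw hwv => h₂.2 v hv w (h₁.2 v (h₂.1 v hv) w hw hwv) hwv⟩

/-- `(Q, R)` is the tree of finite sets of natural numbers, ordered by end-extension. -/
structure IsCohenPoset (Q R : ZFSet.{u}) : Prop where
  mem_iff : ∀ z, z ∈ Q ↔ ∃ n, z ⊆ natSet n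
  pair_mem_iff : ∀ s t, ZFSet.pair s t ∈ R ↔ s ∈ Q ∧ t ∈ Q ∧ EndExtends s t
  subset_prod : R ⊆ Q.prod Q

theorem IsCohenPoset.isPoset {Q R : ZFSet.{u}} (h : IsCohenPoset Q R) : IsPoset Q R where
  nonempty := ⟨natSet 0, (h.mem_iff _).2 ⟨0, fun _ hz => hz⟩⟩
  subset_prod := h.subset_prod
  refl p hp := (h.pair_mem_iff _ _).2 ⟨hp, hp, .refl p⟩
  antisymm p q hpq hqp := by
    obtain ⟨-, -, h1⟩ := (h.pair_mem_iff _ _).1 hpq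
    obtain ⟨-, -, h2⟩ := (h.pair_mem_iff _ _).1 hqp
    exact ZFSet.ext fun z => ⟨h2.1 z, h1.1 z⟩
  trans p q r hpq hqr := by
    obtain ⟨hp, -, h1⟩ := (h.pair_mem_iff _ _).1 hpq
    obtain ⟨-, hr, h2⟩ := (h.pair_mem_iff _ _).1 hqr
    exact (h.pair_mem_iff _ _).2 ⟨hp, hr, h1.trans h2⟩

theorem IsCohenPoset.isCCC {Q R : ZFSet.{u}} (h : IsCohenPoset Q R) : IsCCC Q R := by
  intro A hA
  refine (Set.countable_iUnion fun n => (finite_subsets_natSet n).countable).mono fun p hp => ?_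
  obtain ⟨n, hn⟩ := (h.mem_iff p).1 (hA.1 p hp)
  exact Set.mem_iUnion.2 ⟨n, hn⟩

/-- The Kuratowski pair written with ∈ and = only, as needed to define the Cohen order inside `M`.
-/
theorem mem_orderedPair_iff {s t w : ZFSet.{u}} :
    w ∈ ZFSet.pair s t ↔ (∀ x, x ∈ w ↔ x = s) ∨ ∀ x, x ∈ w ↔ (x = s ∨ x = t) := by
  simp only [ZFSet.pair, ZFSet.mem_pair, ZFSet.ext_iff, ZFSet.mem_singleton]

/-- Cohen forcing belongs to every transitive model. -/
theorem ModelsZFCMinus.exists_isCohenPoset {M : Set ZFSet.{u}} (hM : ModelsZFCMinus M)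
    (hT : IsTransitiveClass M) : ∃ Q R, ZFSet.pair Q R ∈ M ∧ IsCohenPoset Q R := by
  obtain ⟨Q, hQM, hQ⟩ := hM.exists_iUnion_of_finite hT (S := fun n => {z | z ⊆ natSet n})
    finite_subsets_natSet (fun n z hz => hM.mem_of_subset_natSet hT hz)
    (φ := fun z x => ∀ w : M, w.1 ∈ z.1 → w.1 ∈ x.1)
    (fun _ _ => .all (.imp (.mem _ _) (.mem _ _)))
    (fun n z x hx => by
      rw [← hx]
      exact ⟨fun h w hw => h ⟨w, hT _ z.2 w hw⟩ hw, fun h w hw => h hw⟩)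
  obtain ⟨R, hRM, hR⟩ := hM.exists_iUnion_of_finite hT
    (S := fun n => {z | ∃ s t, s ⊆ natSet n ∧ t ⊆ natSet n ∧ EndExtends s t ∧ z = ZFSet.pair s t})
    (fun n => by
      refine ((finite_subsets_natSet n).image2 ZFSet.pair (finite_subsets_natSet n)).subset ?_
      rintro z ⟨s, t, hs, ht, -, rfl⟩
      exact ⟨s, hs, t, ht, rfl⟩)
    (by
      rintro n z ⟨s, t, hs, ht, -, rfl⟩
      exact hM.orderedPair_mem hT (hM.mem_of_subset_natSet hT hs) (hM.mem_of_subset_natSet hT ht))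
    (φ := fun z x => ∃ s t : M, (∀ w : M, w.1 ∈ s.1 → w.1 ∈ x.1) ∧
      (∀ w : M, w.1 ∈ t.1 → w.1 ∈ x.1) ∧
      ((∀ w : M, w.1 ∈ t.1 → w.1 ∈ s.1) ∧
        ∀ v : M, v.1 ∈ t.1 → ∀ w : M, w.1 ∈ s.1 → w.1 ∈ v.1 → w.1 ∈ t.1) ∧
      ∀ w : M, w.1 ∈ z.1 ↔ ((∀ y : M, y.1 ∈ w.1 ↔ y = s) ∨ ∀ y : M, y.1 ∈ w.1 ↔ (y = s ∨ y = t)))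
    (fun _ _ => .ex (.ex (.and (.all (.imp (.mem _ _) (.mem _ _)))
      (.and (.all (.imp (.mem _ _) (.mem _ _)))
      (.and (.and (.all (.imp (.mem _ _) (.mem _ _)))
        (.all (.imp (.mem _ _) (.all (.imp (.mem _ _) (.imp (.mem _ _) (.mem _ _)))))))
      (.all (.iff (.mem _ _) (.or (.all (.iff (.mem _ _) (.eq _ _)))
        (.all (.iff (.mem _ _) (.or (.eq _ _) (.eq _ _))))))))))))
    (fun n z x hx => by
      -- Absoluteness: since `M` is transitive, quantifiers bounded by a member of `M` mean the same
      -- in `M` and in V.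
      have hall : ∀ (a : M) (p : ZFSet.{u} → Prop),
          (∀ w : M, w.1 ∈ a.1 → p w.1) ↔ ∀ w ∈ a.1, p w := fun a p =>
        ⟨fun h w hw => h ⟨w, hT _ a.2 w hw⟩ hw, fun h w hw => h _ hw⟩
      have hsing : ∀ s w : M, (∀ y : M, y.1 ∈ w.1 ↔ y = s) ↔ ∀ y, y ∈ w.1 ↔ y = s.1 := by
        intro s w
        constructor
        · intro h y
          constructor
          · exact fun hy => congrArg Subtype.val ((h ⟨y, hT _ w.2 y hy⟩).1 hy)
          · rintro rfl
            exact (h s).2 rfl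
        · exact fun h y => (h y.1).trans Subtype.ext_iff.symm
      have hpair : ∀ s t w : M, (∀ y : M, y.1 ∈ w.1 ↔ (y = s ∨ y = t)) ↔
          ∀ y, y ∈ w.1 ↔ (y = s.1 ∨ y = t.1) := by
        intro s t w
        constructor
        · intro h y
          constructor
          · exact fun hy => ((h ⟨y, hT _ w.2 y hy⟩).1 hy).imp (congrArg Subtype.val)
              (congrArg Subtype.val)
          · rintro (rfl | rfl)
            · exact (h s).2 (Or.inl rfl)
            · exact (h t).2 (Or.inr rfl)
        · exact fun h y => (h y.1).trans (or_congr Subtype.ext_iff.symm Subtype.ext_iff.symm)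
      have hend : ∀ s t : M, ((∀ w : M, w.1 ∈ t.1 → w.1 ∈ s.1) ∧
          ∀ v : M, v.1 ∈ t.1 → ∀ w : M, w.1 ∈ s.1 → w.1 ∈ v.1 → w.1 ∈ t.1) ↔
          EndExtends s.1 t.1 := by
        intro s t
        refine and_congr (hall t (· ∈ s.1)) ?_
        simp_rw [fun v : M => hall s fun w => w ∈ v.1 → w ∈ t.1]
        exact hall t fun v => ∀ w ∈ s.1, w ∈ v → w ∈ t.1
      simp_rw [hsing, hpair, ← mem_orderedPair_iff, hend, Set.mem_ofPred_eq]
      constructor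
      · rintro ⟨s, t, hs, ht, he, hz⟩
        refine ⟨s.1, t.1, ?_, ?_, he, ZFSet.ext fun w => ⟨fun hw => ?_, fun hw => ?_⟩⟩
        · exact fun w hw => hx ▸ (hall s (· ∈ x.1)).1 hs w hw
        · exact fun w hw => hx ▸ (hall t (· ∈ x.1)).1 ht w hw
        · exact (hz ⟨w, hT _ z.2 w hw⟩).1 hw
        · exact (hz ⟨w, hT _ (hM.orderedPair_mem hT s.2 t.2) w hw⟩).2 hw
      · rintro ⟨s, t, hs, ht, he, hz⟩
        refine ⟨⟨s, hM.mem_of_subset_natSet hT hs⟩, ⟨t, hM.mem_of_subset_natSet hT ht⟩,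
          fun w hw => hx ▸ hs hw, fun w hw => hx ▸ ht hw, he, fun w => by rw [hz]⟩)
  have hpair : ∀ s t, ZFSet.pair s t ∈ R ↔ s ∈ Q ∧ t ∈ Q ∧ EndExtends s t := by
    intro s t
    rw [hR, hQ, hQ]
    constructor
    · rintro ⟨n, s', t', hs, ht, he, h⟩
      obtain ⟨rfl, rfl⟩ := ZFSet.pair_inj.1 h
      exact ⟨⟨n, hs⟩, ⟨n, ht⟩, he⟩
    · rintro ⟨⟨m, hs⟩, ⟨n, ht⟩, he⟩
      exact ⟨max m n, s, t, fun _ h => natSet_mono (le_max_left m n) (hs h),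
        fun _ h => natSet_mono (le_max_right m n) (ht h), he, rfl⟩
  refine ⟨Q, R, hM.orderedPair_mem hT hQM hRM, hQ, hpair, fun z hz => ?_⟩
  obtain ⟨n, s, t, hs, ht, -, rfl⟩ := (hR z).1 hz
  exact ZFSet.pair_mem_prod.2 ⟨(hQ s).2 ⟨n, hs⟩, (hQ t).2 ⟨n, ht⟩⟩

/-! ### Martin's Axiom for countable preorders -/

/-- Martin's Axiom for countable preorders, for fewer than continuum many dense sets. -/
def CountableMA : Prop :=
  ∀ (P : Type) (r : P → P → Prop), Countable P → Nonempty P → (∀ p, r p p) →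
    (∀ p q s, r p q → r q s → r p s) →
    ∀ (ι : Type) (D : ι → Set P), #ι < 𝔠 → (∀ i p, ∃ d ∈ D i, r d p) →
      ∃ G : Set P, G.Nonempty ∧ (∀ p ∈ G, ∀ q ∈ G, ∃ s ∈ G, r s p ∧ r s q) ∧
        ∀ i, (G ∩ D i).Nonempty

open Classical in
/-- Go through the sequence `e`, descending to `e n` at each stage `n ∈ s` where this is
possible. -/
noncomputable def descend {P : Type} (r : P → P → Prop) (e : ℕ → P) (s : Set ℕ) : ℕ → P
  | 0 => e 0
  | n + 1 => if n ∈ s ∧ r (e n) (descend r e s n) then e n else descend r e s n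

section Descend

variable {P : Type} {r : P → P → Prop} {e : ℕ → P}

theorem descend_antitone (hr : ∀ p, r p p) (ht : ∀ p q s, r p q → r q s → r p s) (s : Set ℕ)
    {m n : ℕ} (h : m ≤ n) : r (descend r e s n) (descend r e s m) := by
  induction n, h using Nat.le_induction with
  | base => exact hr _
  | succ n _ ih =>
    refine ht _ _ _ ?_ ih
    rw [descend]
    split_ifs with h
    · exact h.2
    · exact hr _

theorem descend_congr {s t : Set ℕ} {n : ℕ} (h : ∀ k < n, k ∈ s ↔ k ∈ t) :
    descend r e s n = descend r e t n := by
  induction n with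
  | zero => rfl
  | succ n ih =>
    rw [descend, descend, ih fun k hk => h k (hk.trans n.lt_succ_self)]
    rw [propext (h n n.lt_succ_self)]

theorem descend_eq_of_notMem {s : Set ℕ} {m n : ℕ} (hmn : m ≤ n) (h : ∀ k ∈ s, k < m) :
    descend r e s n = descend r e s m := by
  induction n, hmn using Nat.le_induction with
  | base => rfl
  | succ n hmn ih =>
    rw [descend, if_neg fun hn => (h n hn.1).not_ge hmn, ih]

end Descend

/-- The set of natural numbers coded by a set of von Neumann natural numbers. -/
def decode (q : ZFSet.{u}) : Set ℕ := {n | natSet n ∈ q}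

theorem lt_of_mem_decode {q : ZFSet.{u}} {N : ℕ} (h : q ⊆ natSet N) : ∀ k ∈ decode q, k < N :=
  fun _ hk => natSet_mem_natSet.1 (h hk)

/-- End-extending `t` freezes membership only below elements of `t`. Cutting at the least bound,
which is 0 or the successor of an element of `t`, ensures that everything below the cut is frozen.
-/
theorem exists_least_bound {t : ZFSet.{u}} {N : ℕ} (h : t ⊆ natSet N) :
    ∃ n ≤ N, t ⊆ natSet n ∧ ∀ m, n = m + 1 → natSet m ∈ t := by
  induction N with
  | zero => exact ⟨0, le_rfl, h, by simp⟩
  | succ N ih =>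
    by_cases hN : natSet N ∈ t
    · exact ⟨N + 1, le_rfl, h, fun m hm => by rwa [← Nat.succ_injective hm]⟩
    · obtain ⟨n, hn, h'⟩ := ih fun z hz => by
        rcases ZFSet.mem_insert_iff.1 (h hz) with rfl | hz'
        · exact absurd hz hN
        · exact hz'
      exact ⟨n, hn.trans N.le_succ, h'⟩

/-- Monotonicity of the projection: `s` and `t` agree below the least bound of `t`, so both runs
coincide up to there; afterwards the run of `t` is constant and that of `s` can only descend. -/
theorem descend_endExtends {P : Type} {r : P → P → Prop} {e : ℕ → P} (hr : ∀ p, r p p)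
    (htr : ∀ p q s, r p q → r q s → r p s) {s t : ZFSet.{u}} (h : EndExtends s t) {m n : ℕ}
    (hs : s ⊆ natSet m) (ht : t ⊆ natSet n) :
    r (descend r e (decode s) m) (descend r e (decode t) n) := by
  obtain ⟨k, hkn, htk, hk⟩ := exists_least_bound ht
  rw [descend_eq_of_notMem hkn (lt_of_mem_decode htk)]
  have hst : descend r e (decode s) k = descend r e (decode t) k := by
    refine descend_congr fun j hj => ⟨fun hjs => ?_, fun hjt => h.1 _ hjt⟩
    rcases k with _ | k
    · omega
    · rcases Nat.lt_succ_iff_lt_or_eq.1 hj with hj | rfl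
      · exact h.2 _ (hk k rfl) _ hjs (natSet_mem_natSet.2 hj)
      · exact hk j rfl
  rw [← hst]
  refine descend_antitone hr htr _ ?_
  rcases k with _ | k
  · exact Nat.zero_le _
  · exact natSet_mem_natSet.1 (hs (h.1 _ (hk k rfl)))

/-- Sending `q` to the final value of its run is a projection: besides being monotone, it realises
every `d` below the value of `t` at an end-extension of `t`. Dense sets therefore pull back to dense
sets, and filters push forward to directed sets. -/
theorem countableMA_of_isCohenPoset {Q R : ZFSet.{u}} (hC : IsCohenPoset Q R)
    (hMA : MAConclusion Q R) : CountableMA := by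
  intro P r _ _ hr htr ι D hι hD
  obtain ⟨f, hf⟩ := exists_surjective_nat P
  -- Each element is listed infinitely often, so it can be chosen at a stage beyond any given
  -- condition.
  let e : ℕ → P := fun n => f n.unpair.1
  have he : ∀ p N, ∃ n ≥ N, e n = p := by
    intro p N
    obtain ⟨a, rfl⟩ := hf p
    exact ⟨Nat.pair a N, Nat.right_le_pair a N, by simp [e]⟩
  -- Any bound `N` of `q` gives the same value, as the run is constant from there on.
  let D' : ι → Set ZFSet.{u} := fun i =>
    {q | q ∈ Q ∧ ∃ N, q ⊆ natSet N ∧ descend r e (decode q) N ∈ D i}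
  have hD' : ∀ i, IsDense Q R (D' i) := by
    refine fun i => ⟨fun p hp => hp.1, fun t ht => ?_⟩
    obtain ⟨N, hN⟩ := (hC.mem_iff t).1 ht
    obtain ⟨d, hdi, hd⟩ := hD i (descend r e (decode t) N)
    obtain ⟨n, hn, rfl⟩ := he d N
    have hsub : (insert (natSet n) t : ZFSet.{u}) ⊆ natSet (n + 1) := by
      intro z hz
      rcases ZFSet.mem_insert_iff.1 hz with rfl | hz
      · exact natSet_mem_natSet.2 n.lt_succ_self
      · exact natSet_mono (by omega) (hN hz)
    have hQ : (insert (natSet n) t : ZFSet.{u}) ∈ Q := (hC.mem_iff _).2 ⟨_, hsub⟩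
    -- Since `n` bounds `t`, adding it is an end-extension; the run reaches stage `n` at the old
    -- value and moves to `e n` at stage `n + 1`.
    refine ⟨insert (natSet n) t, ⟨hQ, n + 1, hsub, ?_⟩, (hC.pair_mem_iff _ _).2 ⟨hQ, ht, ?_⟩⟩
    · have h1 : descend r e (decode (insert (natSet n) t)) n = descend r e (decode t) N := by
        rw [← descend_eq_of_notMem hn (lt_of_mem_decode hN)]
        refine descend_congr fun k hk => ?_
        refine ZFSet.mem_insert_iff.trans (or_iff_right fun h => ?_)
        exact hk.ne (natSet_injective h)
      rwa [descend, h1, if_pos ⟨ZFSet.mem_insert_iff.2 (Or.inl rfl), hd⟩]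
    · refine ⟨fun v hv => ZFSet.mem_insert_iff.2 (Or.inr hv), fun v hv w hw hwv => ?_⟩
      rcases ZFSet.mem_insert_iff.1 hw with rfl | hw
      · have := natSet_mono (by omega) (hN hv) |> fun h : v ∈ natSet n => h
        exact absurd hwv (ZFSet.mem_asymm this)
      · exact hw
  have hcard : #(Set.range D') < 𝔠 := by
    have h := Cardinal.mk_range_le_lift (f := D')
    exact Cardinal.lift_lt_continuum.1 (h.trans_lt (Cardinal.lift_lt_continuum.2 hι))
  obtain ⟨F, hF, hFD⟩ := hMA (Set.range D') hcard (by rintro _ ⟨i, rfl⟩; exact hD' i)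
  refine ⟨{p | ∃ q ∈ F, ∃ N, q ⊆ natSet N ∧ descend r e (decode q) N = p}, ?_, ?_, fun i => ?_⟩
  · obtain ⟨q, hq⟩ := hF.nonempty
    obtain ⟨N, hN⟩ := (hC.mem_iff q).1 (hF.subset q hq)
    exact ⟨_, q, hq, N, hN, rfl⟩
  · rintro _ ⟨p, hp, m, hm, rfl⟩ _ ⟨q, hq, n, hn, rfl⟩
    obtain ⟨s, hs, hsp, hsq⟩ := hF.directed p hp q hq
    obtain ⟨N, hN⟩ := (hC.mem_iff s).1 (hF.subset s hs)
    exact ⟨_, ⟨s, hs, N, hN, rfl⟩,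
      descend_endExtends hr htr ((hC.pair_mem_iff _ _).1 hsp).2.2 hN hm,
      descend_endExtends hr htr ((hC.pair_mem_iff _ _).1 hsq).2.2 hN hn⟩
  · obtain ⟨q, hq, -, N, hN, hd⟩ := hFD (D' i) ⟨i, rfl⟩
    exact ⟨_, ⟨q, hq, N, hN, rfl⟩, hd⟩

/-- The local grounded Martin's Axiom implies Martin's Axiom for countable preorders. -/
theorem LocalGroundedMA.countableMA (h : LocalGroundedMA.{u}) : CountableMA := by
  obtain ⟨κ, -, M, hT, hM, -, -, hMA⟩ := h
  obtain ⟨Q, R, hQR, hC⟩ := hM.exists_isCohenPoset hT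
  exact countableMA_of_isCohenPoset hC (hMA Q R hQR hC.isPoset hC.isCCC)

/-! ### Lower bounds -/

/-- A sequence of members of `X` that meets fewer than continuum many dense sets of finite
sequences. -/
theorem CountableMA.exists_generic_seq (h : CountableMA) {X : Type} [Countable X] [Nonempty X]
    {ι : Type} (hι : #ι < 𝔠) (D : ι → Set (List X))
    (hD : ∀ i p, ∃ l, p ++ l ∈ D i) :
    ∃ g : ℕ → X, ∀ i, ∃ s ∈ D i, ∀ m x, s[m]? = some x → g m = x := by
  obtain ⟨G, -, hG, hGD⟩ := h (List X) (fun p q => q <+: p) inferInstance inferInstance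
    List.prefix_refl (fun _ _ _ h₁ h₂ => h₂.trans h₁) ι D hι fun i p => by
      obtain ⟨l, hl⟩ := hD i p
      exact ⟨p ++ l, hl, List.prefix_append p l⟩
  have hmono : ∀ {s t : List X} {m : ℕ} {x : X}, s <+: t → s[m]? = some x → t[m]? = some x := by
    rintro s _ m x ⟨l, rfl⟩ h
    obtain ⟨hm, -⟩ := List.getElem?_eq_some_iff.1 h
    rwa [List.getElem?_append_left hm]
  have hcons : ∀ m : ℕ, ∃ y : X, ∀ s ∈ G, ∀ x, s[m]? = some x → y = x := by
    intro m
    by_cases hm : ∃ s ∈ G, ∃ x, s[m]? = some x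
    · obtain ⟨s, hs, y, hy⟩ := hm
      refine ⟨y, fun t ht x hx => ?_⟩
      obtain ⟨u, -, hsu, htu⟩ := hG s hs t ht
      exact Option.some_injective _ ((hmono hsu hy).symm.trans (hmono htu hx))
    · push Not at hm
      -- No member of `G` decides this coordinate, so any value will do.
      exact ⟨Classical.arbitrary X, fun s hs x hx => absurd hx (hm s hs x)⟩
  choose g hg using hcons
  refine ⟨g, fun i => ?_⟩
  obtain ⟨s, hsG, hsD⟩ := hGD i
  exact ⟨s, hsD, fun m x hx => hg m s hsG x hx⟩

/-- Padding up to length `m + 1` prescribes the value at `m`; this is the source of density for the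
conditions on generic sequences. -/
theorem getElem?_append_replicate {X : Type} (p : List X) (x : X) {m : ℕ} (hm : p.length ≤ m) :
    (p ++ List.replicate (m + 1 - p.length) x)[m]? = some x := by
  rw [List.getElem?_append_right hm, List.getElem?_replicate, if_pos (by omega)]

theorem mul_aleph0_lt_continuum {c : Cardinal.{0}} (h : c < 𝔠) : c * ℵ₀ < 𝔠 :=
  Cardinal.mul_lt_of_lt Cardinal.aleph0_le_continuum h Cardinal.aleph0_lt_continuum

/-- A generic sequence exceeds each `f` in the family beyond every `n`, so nothing there dominates
it. -/
theorem CountableMA.continuum_le_of_dominating (h : CountableMA) {ℱ : Set (ℕ → ℕ)}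
    (hℱ : ∀ g : ℕ → ℕ, ∃ f ∈ ℱ, ∀ᶠ n in Filter.atTop, g n ≤ f n) : 𝔠 ≤ #ℱ := by
  by_contra! hlt
  have hι : #(ℱ × ℕ) < 𝔠 := by
    simpa using mul_aleph0_lt_continuum hlt
  obtain ⟨g, hg⟩ := h.exists_generic_seq (X := ℕ) hι
    (fun i => {s | ∃ m ≥ i.2, s[m]? = some (i.1.1 m + 1)}) fun i p =>
      ⟨_, max i.2 p.length, le_max_left _ _, getElem?_append_replicate p _ (le_max_right _ _)⟩
  obtain ⟨f, hf, hev⟩ := hℱ g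
  obtain ⟨n, hn⟩ := Filter.eventually_atTop.1 hev
  obtain ⟨s, ⟨m, hm, hs⟩, hgs⟩ := hg (⟨f, hf⟩, n)
  have h1 := hgs m _ hs
  have h2 := hn m hm
  simp only at h1
  omega

/-- A generic binary sequence takes both values infinitely often on each `x` of the family; the
Boolean index names the value to be taken. -/
theorem CountableMA.continuum_le_of_reaping (h : CountableMA) {ℛ : Set (Set ℕ)}
    (hinf : ∀ x ∈ ℛ, x.Infinite) (hℛ : ¬ ∃ s : Set ℕ, ∀ x ∈ ℛ, Splits s x) : 𝔠 ≤ #ℛ := by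
  by_contra! hlt
  have hι : #(ℛ × ℕ × Bool) < 𝔠 := by
    have : #(ℕ × Bool) = ℵ₀ := Cardinal.mk_eq_aleph0 _
    rw [Cardinal.mk_prod, this]
    simpa using mul_aleph0_lt_continuum hlt
  obtain ⟨g, hg⟩ := h.exists_generic_seq (X := Bool) hι
    (fun i => {s | ∃ m ∈ i.1.1, i.2.1 < m ∧ s[m]? = some i.2.2}) fun i p => by
      obtain ⟨m, hm, hlt⟩ := (hinf _ i.1.2).exists_gt (max i.2.1 p.length)
      exact ⟨_, m, hm, (le_max_left _ _).trans_lt hlt,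
        getElem?_append_replicate p _ ((le_max_right _ _).trans hlt.le)⟩
  refine hℛ ⟨{m | g m = true}, fun x hx => ⟨?_, ?_⟩⟩
  · refine Set.infinite_of_forall_exists_gt fun n => ?_
    obtain ⟨s, ⟨m, hm, hnm, hs⟩, hgs⟩ := hg (⟨x, hx⟩, n, true)
    exact ⟨m, ⟨hm, hgs m _ hs⟩, hnm⟩
  · refine Set.infinite_of_forall_exists_gt fun n => ?_
    obtain ⟨s, ⟨m, hm, hnm, hs⟩, hgs⟩ := hg (⟨x, hx⟩, n, false)
    refine ⟨m, ⟨hm, fun h => ?_⟩, hnm⟩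
    have h1 : g m = false := hgs m _ hs
    have h2 : g m = true := h
    simp [h1] at h2

/-- A meager set misses a countable intersection of dense open sets. -/
theorem exists_seq_of_isMeagre {A : Set ℝ} (hA : IsMeagre A) :
    ∃ U : ℕ → Set ℝ, (∀ n, IsOpen (U n)) ∧ (∀ n, Dense (U n)) ∧ ∀ x ∈ A, ∃ n, x ∉ U n := by
  obtain ⟨S, ho, hd, hc, hS⟩ := mem_residual_iff.1 hA
  -- Adding the whole line makes the family nonempty, so that a sequence can enumerate it.
  obtain ⟨U, hU⟩ := (hc.insert Set.univ).exists_eq_range (Set.insert_nonempty _ _)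
  have hmem : ∀ n, U n = Set.univ ∨ U n ∈ S := fun n =>
    Set.mem_insert_iff.1 (hU ▸ Set.mem_range_self n)
  refine ⟨U, fun n => ?_, fun n => ?_, fun x hx => ?_⟩
  · rcases hmem n with h | h
    · exact h ▸ isOpen_univ
    · exact ho _ h
  · rcases hmem n with h | h
    · exact h ▸ dense_univ
    · exact hd _ h
  · by_contra! hall
    refine hS (Set.mem_sInter.2 fun t ht => ?_) hx
    obtain ⟨n, rfl⟩ : t ∈ Set.range U := hU ▸ Set.mem_insert_of_mem _ ht
    exact hall n

/-- Force with nondegenerate closed rational intervals. By compactness a directed family of them has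
a common point, which lies in all the dense open sets met and hence in no member of the cover. -/
theorem CountableMA.continuum_le_of_cover (h : CountableMA) {𝒜 : Set (Set ℝ)}
    (h𝒜 : 𝒜 ⊆ meagerIdeal) (hcov : ⋃₀ 𝒜 = Set.univ) : 𝔠 ≤ #𝒜 := by
  by_contra! hlt
  have hι : #(𝒜 × ℕ) < 𝔠 := by
    simpa using mul_aleph0_lt_continuum hlt
  choose U hUo hUd hU using fun A : 𝒜 => exists_seq_of_isMeagre (h𝒜 A.2)
  let I : {p : ℚ × ℚ // p.1 < p.2} → Set ℝ := fun p => Set.Icc (p.1.1 : ℝ) p.1.2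
  obtain ⟨G, hne, hG, hGD⟩ := h {p : ℚ × ℚ // p.1 < p.2} (fun p q => I p ⊆ I q) inferInstance
    ⟨⟨(0, 1), zero_lt_one⟩⟩ (fun _ => subset_rfl) (fun _ _ _ h₁ h₂ => h₁.trans h₂)
    (𝒜 × ℕ) (fun i => {p | I p ⊆ U i.1 i.2}) hι fun i p => by
      have hp : (p.1.1 : ℝ) < p.1.2 := Rat.cast_lt.2 p.2
      obtain ⟨x, hx, hxU⟩ := (hUd i.1 i.2).inter_open_nonempty (Set.Ioo (p.1.1 : ℝ) p.1.2)
        isOpen_Ioo (Set.nonempty_Ioo.2 hp)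
      obtain ⟨ε, hε, hball⟩ := Metric.isOpen_iff.1 (isOpen_Ioo.inter (hUo i.1 i.2)) x ⟨hx, hxU⟩
      obtain ⟨a, ha1, ha2⟩ := exists_rat_btwn (sub_lt_self x hε)
      obtain ⟨b, hb1, hb2⟩ := exists_rat_btwn (lt_add_of_pos_right x hε)
      have hsub : Set.Icc (a : ℝ) b ⊆ Set.Ioo (p.1.1 : ℝ) p.1.2 ∩ U i.1 i.2 := by
        refine fun y hy => hball ?_
        rw [Real.ball_eq_Ioo]
        exact ⟨ha1.trans_le hy.1, hy.2.trans_lt hb2⟩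
      exact ⟨⟨(a, b), Rat.cast_lt.1 (ha2.trans hb1)⟩, fun y hy => (hsub hy).2,
        fun y hy => Set.Ioo_subset_Icc_self (hsub hy).1⟩
  have : Nonempty G := hne.to_subtype
  obtain ⟨x, hx⟩ := IsCompact.nonempty_iInter_of_directed_nonempty_isCompact_isClosed
    (fun p : G => I p.1)
    (fun p q => by
      obtain ⟨s, hs, h1, h2⟩ := hG p.1 p.2 q.1 q.2
      exact ⟨⟨s, hs⟩, h1, h2⟩)
    (fun p => Set.nonempty_Icc.2 (Rat.cast_le.2 p.1.2.le)) (fun _ => isCompact_Icc)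
    fun _ => isClosed_Icc
  obtain ⟨A, hA, hxA⟩ := Set.mem_sUnion.1 (hcov ▸ Set.mem_univ x)
  obtain ⟨n, hn⟩ := hU ⟨A, hA⟩ x hxA
  obtain ⟨p, hpG, hp⟩ := hGD (⟨A, hA⟩, n)
  exact hn (hp (Set.mem_iInter.1 hx ⟨p, hpG⟩))

/-- The complement of the null set of Liouville numbers is meager. -/
theorem isMeagre_not_liouville : IsMeagre {x : ℝ | ¬ Liouville x} := by
  have h := eventually_residual_liouville
  unfold IsMeagre
  filter_upwards [h] with x hx using not_not.2 hx

/-- Rothberger's argument, with L the comeager null set of Liouville numbers. Fewer than 𝔠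
translates a + (ℝ \ L), a ∈ A, miss some x; then x - a ∈ L for every a ∈ A, so A lies in the null
set x - L. -/
theorem CountableMA.continuum_le_of_not_null (h : CountableMA) {A : Set ℝ}
    (hA : A ∉ nullIdeal) : 𝔠 ≤ #A := by
  by_contra! hlt
  let B : A → Set ℝ := fun a => (fun x => x - a.1) ⁻¹' {x | ¬ Liouville x}
  have hB : Set.range B ⊆ meagerIdeal := by
    rintro _ ⟨a, rfl⟩
    exact isMeagre_not_liouville.preimage_of_isOpenMap (by fun_prop)
      (Homeomorph.subRight a.1).isOpenMap
  have hne : ⋃₀ Set.range B ≠ Set.univ := fun hcov =>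
    (h.continuum_le_of_cover hB hcov).not_gt (Cardinal.mk_range_le.trans_lt hlt)
  obtain ⟨x, hx⟩ := (Set.ne_univ_iff_exists_notMem _).1 hne
  refine hA (MeasureTheory.measure_mono_null (t := (fun y => x - y) ⁻¹' {y | Liouville y})
    (fun a ha => ?_) ?_)
  · by_contra hn
    exact hx (Set.mem_sUnion.2 ⟨B ⟨a, ha⟩, ⟨_, rfl⟩, hn⟩)
  · exact (MeasureTheory.Measure.measurePreserving_sub_left MeasureTheory.volume
      x).quasiMeasurePreserving.preimage_null volume_setOfPred_liouville

theorem isMeagre_singleton (x : ℝ) : IsMeagre ({x} : Set ℝ) :=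
  (isClosed_singleton.isNowhereDense_iff.2 (interior_singleton x)).isMeagre

/-- Singletons are meager, so a cofinal family covers the line. -/
theorem CountableMA.continuum_le_of_cofinal_meager (h : CountableMA) {𝒜 : Set (Set ℝ)}
    (h𝒜 : 𝒜 ⊆ meagerIdeal) (hcof : ∀ B ∈ meagerIdeal, ∃ A ∈ 𝒜, B ⊆ A) : 𝔠 ≤ #𝒜 := by
  refine h.continuum_le_of_cover h𝒜 (Set.eq_univ_of_forall fun x => ?_)
  obtain ⟨A, hA, hx⟩ := hcof {x} (isMeagre_singleton x)
  exact ⟨A, hA, hx rfl⟩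

/-- Choosing a point outside each member of a cofinal family yields a set contained in no member,
hence not null. -/
theorem CountableMA.continuum_le_of_cofinal_null (h : CountableMA) {𝒜 : Set (Set ℝ)}
    (h𝒜 : 𝒜 ⊆ nullIdeal) (hcof : ∀ B ∈ nullIdeal, ∃ A ∈ 𝒜, B ⊆ A) : 𝔠 ≤ #𝒜 := by
  have hne : ∀ A : 𝒜, ∃ x, x ∉ A.1 := by
    intro A
    by_contra! hall
    have h0 : MeasureTheory.volume A.1 = 0 := h𝒜 A.2
    simp [Set.eq_univ_of_forall hall] at h0
  choose x hx using hne
  have hnull : Set.range x ∉ nullIdeal := by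
    intro hmem
    obtain ⟨A, hA, hsub⟩ := hcof _ hmem
    exact hx ⟨A, hA⟩ (hsub ⟨_, rfl⟩)
  exact (h.continuum_le_of_not_null hnull).trans Cardinal.mk_range_le

/-! ### Upper bounds -/

theorem mk_measurableSet_real_le : #{A : Set ℝ // MeasurableSet A} ≤ 𝔠 := by
  obtain ⟨b, hbc, -, hb⟩ := TopologicalSpace.exists_countable_basis ℝ
  have h := MeasurableSpace.cardinal_measurableSet_le_continuum (s := b)
    ((Cardinal.mk_le_aleph0_iff.2 hbc.to_subtype).trans Cardinal.aleph0_le_continuum)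
  rwa [← hb.borel_eq_generateFrom, ← BorelSpace.measurable_eq] at h

/-- There are only 𝔠 Borel sets, so an ideal with a Borel base has cofinality at most 𝔠. -/
theorem exists_cofinal_of_measurable {I : Set (Set ℝ)}
    (hI : ∀ B ∈ I, ∃ A ∈ I, MeasurableSet A ∧ B ⊆ A) :
    ∃ 𝒜 ⊆ I, (∀ B ∈ I, ∃ A ∈ 𝒜, B ⊆ A) ∧ #𝒜 ≤ 𝔠 := by
  refine ⟨{A ∈ I | MeasurableSet A}, fun A hA => hA.1, fun B hB => ?_, ?_⟩
  · obtain ⟨A, hA, hm, hBA⟩ := hI B hB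
    exact ⟨A, ⟨hA, hm⟩, hBA⟩
  · exact (Cardinal.mk_le_mk_of_subset fun A hA => hA.2).trans mk_measurableSet_real_le

/-- The complement of a meager set contains a dense Gδ set, whose complement is Borel and meager. -/
theorem exists_measurable_meager_superset {B : Set ℝ} (hB : B ∈ meagerIdeal) :
    ∃ A ∈ meagerIdeal, MeasurableSet A ∧ B ⊆ A := by
  obtain ⟨t, ht, hG, hd⟩ := mem_residual.1 (show Bᶜ ∈ residual ℝ from hB)
  refine ⟨tᶜ, ?_, hG.measurableSet.compl, Set.subset_compl_comm.1 ht⟩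
  change tᶜᶜ ∈ residual ℝ
  rw [compl_compl]
  exact mem_residual.2 ⟨t, subset_rfl, hG, hd⟩

theorem exists_measurable_null_superset {B : Set ℝ} (hB : B ∈ nullIdeal) :
    ∃ A ∈ nullIdeal, MeasurableSet A ∧ B ⊆ A := by
  obtain ⟨A, hBA, hm, h0⟩ := MeasureTheory.exists_measurable_superset_of_null hB
  exact ⟨A, h0, hm, hBA⟩

/-! ### The values of the cardinal characteristics -/

/-- A witness is needed for the lower bound too, because the infimum of the empty set is 0. -/
theorem sInf_eq_continuum {S : Set Cardinal.{0}} (hex : ∃ c ∈ S, c ≤ 𝔠) (hall : ∀ c ∈ S, 𝔠 ≤ c) :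
    sInf S = 𝔠 := by
  obtain ⟨c, hc, hle⟩ := hex
  exact le_antisymm ((csInf_le' hc).trans hle) (le_csInf ⟨c, hc⟩ hall)

theorem CountableMA.cov_meagerIdeal (h : CountableMA) : cov meagerIdeal = 𝔠 := by
  refine sInf_eq_continuum ⟨_, ⟨Set.range fun x : ℝ => {x}, ?_, ?_, rfl⟩, ?_⟩ ?_
  · rintro _ ⟨x, rfl⟩
    exact isMeagre_singleton x
  · exact Set.eq_univ_of_forall fun x => ⟨{x}, ⟨x, rfl⟩, rfl⟩
  · exact Cardinal.mk_range_le.trans Cardinal.mk_real.le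
  · rintro _ ⟨𝒜, h1, h2, rfl⟩
    exact h.continuum_le_of_cover h1 h2

theorem CountableMA.non_nullIdeal (h : CountableMA) : non nullIdeal = 𝔠 := by
  refine sInf_eq_continuum ⟨_, ⟨Set.univ, ?_, rfl⟩, ?_⟩ ?_
  · simp [nullIdeal]
  · exact (Cardinal.mk_set_le _).trans Cardinal.mk_real.le
  · rintro _ ⟨A, hA, rfl⟩
    exact h.continuum_le_of_not_null hA

theorem CountableMA.dominatingNumber_eq (h : CountableMA) : dominatingNumber = 𝔠 := by
  refine sInf_eq_continuum ⟨_, ⟨Set.univ, fun g => ⟨g, trivial, by simp⟩, rfl⟩, ?_⟩ ?_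
  · exact (Cardinal.mk_set_le _).trans (by simp)
  · rintro _ ⟨ℱ, hℱ, rfl⟩
    exact h.continuum_le_of_dominating hℱ

theorem CountableMA.cof_meagerIdeal (h : CountableMA) : cof meagerIdeal = 𝔠 := by
  obtain ⟨𝒜, h1, h2, h3⟩ := exists_cofinal_of_measurable fun B => exists_measurable_meager_superset
  refine sInf_eq_continuum ⟨_, ⟨𝒜, h1, h2, rfl⟩, h3⟩ ?_
  rintro _ ⟨𝒜, h1, h2, rfl⟩
  exact h.continuum_le_of_cofinal_meager h1 h2

theorem CountableMA.cof_nullIdeal (h : CountableMA) : cof nullIdeal = 𝔠 := by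
  obtain ⟨𝒜, h1, h2, h3⟩ := exists_cofinal_of_measurable fun B => exists_measurable_null_superset
  refine sInf_eq_continuum ⟨_, ⟨𝒜, h1, h2, rfl⟩, h3⟩ ?_
  rintro _ ⟨𝒜, h1, h2, rfl⟩
  exact h.continuum_le_of_cofinal_null h1 h2

theorem CountableMA.reapingNumber_eq (h : CountableMA) : reapingNumber = 𝔠 := by
  refine sInf_eq_continuum ⟨_, ⟨{x | x.Infinite}, fun _ hx => hx, ?_, rfl⟩, ?_⟩ ?_
  · rintro ⟨s, hs⟩
    -- One of `s` and its complement is infinite, and `s` does not split it.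
    by_cases hf : s.Infinite
    · simpa using (hs s hf).2
    · have hc : sᶜ.Infinite := (Set.not_infinite.1 hf).infinite_compl
      simpa using (hs sᶜ hc).1
  · exact (Cardinal.mk_set_le _).trans (by simp)
  · rintro _ ⟨ℛ, h1, h2, rfl⟩
    exact h.continuum_le_of_reaping h1 h2

end GroundedMA

/-- The local grounded Martin's Axiom implies that the cardinals on the right side of Cichoń's
diagram, and also the reaping number, are equal to the continuum. -/
theorem mainTheorem11 (h : GroundedMA.LocalGroundedMA.{u}) :
    GroundedMA.cov GroundedMA.meagerIdeal = 𝔠 ∧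
    GroundedMA.non GroundedMA.nullIdeal = 𝔠 ∧
    GroundedMA.dominatingNumber = 𝔠 ∧
    GroundedMA.cof GroundedMA.meagerIdeal = 𝔠 ∧
    GroundedMA.cof GroundedMA.nullIdeal = 𝔠 ∧
    GroundedMA.reapingNumber = 𝔠 :=
  have h := h.countableMA
  ⟨h.cov_meagerIdeal, h.non_nullIdeal, h.dominatingNumber_eq, h.cof_meagerIdeal, h.cof_nullIdeal,
    h.reapingNumber_eq⟩
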